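/- Let $St(n,p)=\{U\in\mathbb R^{n\times p}: U^TU=I_p\}$ be the Stiefel manifold, with tangent spaces $T_USt(n,p)=\{\Delta\in\mathbb R^{n\times p}: U^T\Delta=-\Delta^TU\}$ and the canonical metric $\langle\Delta,\tilde\Delta\rangle_U=\operatorname{tr}\big(\Delta^T(I-\tfrac12UU^T)\tilde\Delta\big)$. Let $Exp^{St}_U(\Delta)=\gamma(1)$ be its Riemannian exponential, where $\gamma$ is the geodesic with $\gamma(0)=U$, $\dot\gamma(0)=\Delta$. For a square matrix $V$, $\log_m(V)$ denotes the principal logarithm, i.e. the matrix $L$ with $\exp_m(L)=V$ all of whose eigenvalues have imaginary part in $(-\pi,\pi)$ (if it exists). Let $U\in St(n,p)$, and suppose that $Exp_U^{St}$ is a diffeomorphism from an open neighbourhood $\mathcal V$ of $0$ in $T_USt(n,p)$ onto an open neighbourhood $\mathcal D$ of $U$ in $St(n,p)$; write $Log_U^{St}:\mathcal D\to\mathcal V$ for its inverse. For $\tilde U\in\mathcal D$ put $M=U^T\tilde U$, let $(I-UU^T)\tilde U=QN$ with $Q\in St(n,p)$, $N\in\mathbb R^{p\times p}$, and let $X_0,Y_0\in\mathbb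 R^{p\times p}$ be such that $\begin{pmatrix}M&X_0\\N&Y_0\end{pmatrix}$ is orthogonal. Suppose that $\Phi\in O(p)$ and $A,B\in\mathbb R^{p\times p}$ satisfy $$\log_m\begin{pmatrix}M&X_0\Phi\\N&Y_0\Phi\end{pmatrix}=\begin{pmatrix}A&-B^T\\B&0\end{pmatrix},$$ and that $U^TQB=0$ (which is automatic if $U^TQ=0$, in particular if $(I-UU^T)\tilde U$ has rank $p$). Let $\Delta:=UA+QB$. Then: 1. $\Delta\in T_USt(n,p)$ and $Exp_U^{St}(\Delta)=\tilde U$; and if $\Delta\in\mathcal V$, then $\Delta=Log_U^{St}(\tilde U)$. 2. There is an open neighbourhood $\mathcal D'\subseteq\mathcal D$ of $U$ in $St(n,p)$ (depending only on $U$, $\mathcal V$ and $\mathcal D$) such that, whenever $\tilde U\in\mathcal D'$, every $\Delta$ obtained from $\tilde U$ in this way satisfies $\Delta=Log_U^{St}(\tilde U)$. -/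

import Mathlib

open scoped Matrix ContDiff

/- The entrywise maximum norm, used only to speak of smoothness of maps between (subsets of) the
finite-dimensional spaces of matrices, where all norms are equivalent. -/
attribute [local instance] Matrix.normedAddCommGroup Matrix.normedSpace

noncomputable section

namespace Stiefel

variable {n p : ℕ}

/-- The Stiefel manifold `St(n,p)` of `n × p` matrices with orthonormal columns. -/
def St (n p : ℕ) : Set (Matrix (Fin n) (Fin p) ℝ) :=
  {U | Uᵀ * U = 1}

/-- The tangent space of the Stiefel manifold at `U`, as a subspace of the space of matrices. -/
def tangent (U : Matrix (Fin n) (Fin p) ℝ) : Set (Matrix (Fin n) (Fin p) ℝ) :=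
  {D | Uᵀ * D = -(Dᵀ * U)}

/-- The canonical metric `⟨D, D'⟩_U = tr (Dᵀ (I - ½ U Uᵀ) D')`. -/
def metric (U D D' : Matrix (Fin n) (Fin p) ℝ) : ℝ :=
  (Dᵀ * (1 - (1 / 2 : ℝ) • (U * Uᵀ)) * D').trace

/-- A (complete) geodesic of the canonical metric: a smooth curve `γ : ℝ → St(n,p)` which satisfies
the Euler–Lagrange equations of the kinetic energy `E(x, v) = ½ ⟨v, v⟩_x` on `St(n,p)`, i.e.
`(d/dt ∂E/∂v - ∂E/∂x) ξ = 0` along `(γ, γ')` in every direction `ξ` tangent to `St(n,p)` at the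
point of the curve. Here `∂E/∂v (x, v) ξ = ⟨v, ξ⟩_x` and `∂E/∂x (x, v) ξ` is the derivative of
`½ ⟨v, v⟩_x` with respect to `x` in direction `ξ`. -/
structure IsGeodesic (γ : ℝ → Matrix (Fin n) (Fin p) ℝ) : Prop where
  smooth : ContDiff ℝ ∞ γ
  mem : ∀ t, γ t ∈ St n p
  eulerLagrange : ∀ t, ∀ ξ ∈ tangent (γ t),
    deriv (fun s => metric (γ s) (deriv γ s) ξ) t =
      deriv (fun s : ℝ => (1 / 2 : ℝ) * metric (γ t + s • ξ) (deriv γ t) (deriv γ t)) 0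

open Classical in
/-- The Riemannian exponential `Exp_U^St(D) = γ(1)`, where `γ` is the geodesic of the canonical
metric with `γ(0) = U` and `γ'(0) = D`. -/
def Exp (U D : Matrix (Fin n) (Fin p) ℝ) : Matrix (Fin n) (Fin p) ℝ :=
  if h : ∃ γ : ℝ → Matrix (Fin n) (Fin p) ℝ, IsGeodesic γ ∧ γ 0 = U ∧ deriv γ 0 = D then
    h.choose 1
  else 0

/-- The Riemannian logarithm at `U` belonging to a set `𝒱` of tangent vectors on which `Exp_U^St` is
injective: the inverse of the restriction of `Exp_U^St` to `𝒱`. -/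
def Log (U : Matrix (Fin n) (Fin p) ℝ) (𝒱 : Set (Matrix (Fin n) (Fin p) ℝ)) :
    Matrix (Fin n) (Fin p) ℝ → Matrix (Fin n) (Fin p) ℝ :=
  Function.invFunOn (Exp U) 𝒱

/-- `𝒲` is an open neighbourhood of `W` relative to `S`. -/
def IsOpenNhdIn (S 𝒲 : Set (Matrix (Fin n) (Fin p) ℝ)) (W : Matrix (Fin n) (Fin p) ℝ) : Prop :=
  W ∈ 𝒲 ∧ ∃ O : Set (Matrix (Fin n) (Fin p) ℝ), IsOpen O ∧ 𝒲 = S ∩ O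

/-- `Exp_U^St` is a diffeomorphism from the open neighbourhood `𝒱` of `0` in the tangent space at
`U` onto the open neighbourhood `𝒟` of `U` in `St(n,p)`. -/
structure IsExpDiffeo (U : Matrix (Fin n) (Fin p) ℝ)
    (𝒱 𝒟 : Set (Matrix (Fin n) (Fin p) ℝ)) : Prop where
  nhd_source : IsOpenNhdIn (tangent U) 𝒱 0
  nhd_target : IsOpenNhdIn (St n p) 𝒟 U
  bijOn : Set.BijOn (Exp U) 𝒱 𝒟
  smooth : ContDiffOn ℝ ∞ (Exp U) 𝒱
  smooth_inv : ContDiffOn ℝ ∞ (Log U 𝒱) 𝒟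

/-- `L` is the principal logarithm of the real matrix `V`: `exp L = V`, and all complex eigenvalues
of `L` have imaginary part in `(-π, π)`. -/
def IsPrincipalLog {m : Type*} [Fintype m] [DecidableEq m] (V L : Matrix m m ℝ) : Prop :=
  NormedSpace.exp L = V ∧ ∀ μ ∈ spectrum ℂ (L.map Complex.ofReal), |μ.im| < Real.pi

/-- The data of the matrix equation for the pair `U, W` (with `M = Uᵀ W`):
`Q N = (I - U Uᵀ) W` with `Q` column-orthonormal, `(X₀; Y₀)` an orthogonal completion of `(M; N)`,
`Φ` orthogonal, and `log_m (M, X₀ Φ; N, Y₀ Φ) = (A, -Bᵀ; B, 0)`.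
The field `orth` is automatic as soon as `Uᵀ Q = 0`. -/
structure IsSolution (U W Q : Matrix (Fin n) (Fin p) ℝ)
    (N X₀ Y₀ Φ A B : Matrix (Fin p) (Fin p) ℝ) : Prop where
  Q_mem : Q ∈ St n p
  QN_eq : Q * N = (1 - U * Uᵀ) * W
  completion : Matrix.fromBlocks (Uᵀ * W) X₀ N Y₀ ∈ Matrix.orthogonalGroup (Fin p ⊕ Fin p) ℝ
  Φ_mem : Φ ∈ Matrix.orthogonalGroup (Fin p) ℝ
  log_eq : IsPrincipalLog (Matrix.fromBlocks (Uᵀ * W) (X₀ * Φ) N (Y₀ * Φ))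
    (Matrix.fromBlocks A (-Bᵀ) B 0)
  orth : Uᵀ * (Q * B) = 0

end Stiefel

end

/-!
A matrix which intertwines `exp X` and `exp Y` also intertwines `X` and `Y`, provided that all
eigenvalues of `X` and `Y` have imaginary part in `(-π, π)`. Hence principal logarithms are unique,
and comparing `Lᵀ` with `-L` shows that the principal logarithm `L` of an orthogonal matrix is skew.

The geodesic from `U` with velocity `U A + K`, where `A` is skew and `Uᵀ K = 0`, is the first block
column of `(U K) exp (t Λ)` with `Λ = (A, -KᵀK; 1, 0)`; this works because `Λ` is skew for the
bilinear form `diag (1, KᵀK)`. For `K = Q B` the matrix `J = diag (1, B)` satisfies `L J = J Λ` with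
`L = (A, -Bᵀ; B, 0)`, so that the end point of the geodesic is `(U Q) exp L` restricted to the first
block column, that is, `U M + Q N = W`.

Finally `|θ| ≤ (π / 2) |exp (i θ) - 1|` on `[-π, π]` gives `‖Δ‖ ≤ (π / 2) ‖W - U‖` in the Frobenius
norm, so `Δ` lies in any prescribed neighbourhood of `0` once `W` is close enough to `U`.
-/

namespace Stiefel

open NormedSpace

section MatrixCalculus

variable {𝕜 E l m k : Type*} [RCLike 𝕜] [NormedAddCommGroup E] [NormedSpace ℝ E]

theorem hasDerivAt_matrix_mul [Fintype m] [Finite k] {X : ℝ → Matrix l m 𝕜} {Y : ℝ → Matrix m k 𝕜}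
    {X' : Matrix l m 𝕜} {Y' : Matrix m k 𝕜} {t : ℝ} (hX : HasDerivAt X X' t)
    (hY : HasDerivAt Y Y' t) : HasDerivAt (fun s => X s * Y s) (X' * Y t + X t * Y') t := by
  have := Fintype.ofFinite k
  refine hasDerivAt_pi.2 fun i => hasDerivAt_pi.2 fun j => ?_
  simp only [Matrix.mul_apply, Matrix.add_apply, ← Finset.sum_add_distrib]
  exact HasDerivAt.fun_sum fun a _ =>
    (hasDerivAt_pi.1 (hasDerivAt_pi.1 hX i) a).fun_mul (hasDerivAt_pi.1 (hasDerivAt_pi.1 hY a) j)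

theorem hasDerivAt_matrix_transpose [Finite l] [Finite m] {X : ℝ → Matrix l m 𝕜}
    {X' : Matrix l m 𝕜} {t : ℝ} (hX : HasDerivAt X X' t) : HasDerivAt (fun s => (X s)ᵀ) X'ᵀ t := by
  have := Fintype.ofFinite l
  have := Fintype.ofFinite m
  exact hasDerivAt_pi.2 fun i => hasDerivAt_pi.2 fun j => hasDerivAt_pi.1 (hasDerivAt_pi.1 hX j) i

theorem hasDerivAt_matrix_add_smul [Finite m] (X Y : Matrix l m 𝕜) (t : ℝ) :
    HasDerivAt (fun s : ℝ => X + s • Y) Y t := by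
  have := Fintype.ofFinite m
  exact hasDerivAt_pi.2 fun i => hasDerivAt_pi.2 fun j =>
    (((hasDerivAt_id t).smul_const (Y i j)).const_add (X i j)).congr_deriv (one_smul ℝ (Y i j))

variable [Fintype l] [Fintype m] [Fintype k]

theorem hasDerivAt_matrix_trace {X : ℝ → Matrix m m 𝕜} {X' : Matrix m m 𝕜} {t : ℝ}
    (hX : HasDerivAt X X' t) : HasDerivAt (fun s => (X s).trace) X'.trace t :=
  HasDerivAt.fun_sum fun i _ => hasDerivAt_pi.1 (hasDerivAt_pi.1 hX i) i

theorem contDiff_matrix_mul {r : WithTop ℕ∞} {X : E → Matrix l m 𝕜} {Y : E → Matrix m k 𝕜}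
    (hX : ContDiff ℝ r X) (hY : ContDiff ℝ r Y) : ContDiff ℝ r fun s => X s * Y s := by
  refine contDiff_pi.2 fun i => contDiff_pi.2 fun j => ?_
  simp only [Matrix.mul_apply]
  exact ContDiff.sum fun a _ =>
    (contDiff_pi.1 (contDiff_pi.1 hX i) a).mul (contDiff_pi.1 (contDiff_pi.1 hY a) j)

theorem contDiff_matrix_transpose {r : WithTop ℕ∞} {X : E → Matrix l m 𝕜}
    (hX : ContDiff ℝ r X) : ContDiff ℝ r fun s => (X s)ᵀ :=
  contDiff_pi.2 fun i => contDiff_pi.2 fun j => contDiff_pi.1 (contDiff_pi.1 hX j) i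

theorem hasDerivAt_matrix_exp_smul [DecidableEq m] (X : Matrix m m 𝕜) (t : ℝ) :
    HasDerivAt (fun s : ℝ => exp (s • X)) (exp (t • X) * X) t :=
  @hasDerivAt_exp_smul_const ℝ _ _ Matrix.linftyOpNormedRing Matrix.linftyOpNormedAlgebra
    (inferInstanceAs (CompleteSpace (m → m → 𝕜))) X t

theorem contDiff_infty_of_hasDerivAt {F : E → E} (hF : ContDiff ℝ ∞ F) {f : ℝ → E}
    (hf : ∀ t, HasDerivAt f (F (f t)) t) : ContDiff ℝ ∞ f := by
  have hderiv : deriv f = F ∘ f := funext fun t => (hf t).deriv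
  refine contDiff_infty.2 fun n => ?_
  induction n with
  | zero =>
    exact contDiff_zero.2 (continuous_iff_continuousAt.2 fun t => (hf t).continuousAt)
  | succ n ih =>
    rw [Nat.cast_add, Nat.cast_one, contDiff_succ_iff_deriv, hderiv]
    exact ⟨fun t => (hf t).differentiableAt, by simp,
      (hF.of_le (mod_cast le_top)).comp ih⟩

theorem contDiff_matrix_exp_smul [DecidableEq m] (X : Matrix m m 𝕜) :
    ContDiff ℝ ∞ fun t : ℝ => exp (t • X) :=
  contDiff_infty_of_hasDerivAt (contDiff_matrix_mul contDiff_id contDiff_const)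
    (hasDerivAt_matrix_exp_smul X)

theorem eq_of_hasDerivAt_autonomous {F : E → E} (hF : ContDiff ℝ 1 F) {f g : ℝ → E}
    (hf : ∀ t, HasDerivAt f (F (f t)) t) (hg : ∀ t, HasDerivAt g (F (g t)) t)
    (h₀ : f 0 = g 0) : f = g := by
  have hfc : Continuous f := continuous_iff_continuousAt.2 fun t => (hf t).continuousAt
  have hgc : Continuous g := continuous_iff_continuousAt.2 fun t => (hg t).continuousAt
  funext t
  let r : ℝ := |t| + 1
  have ht : t ∈ Set.Icc (-r) r := abs_le.1 (le_add_of_nonneg_right zero_le_one)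
  have h0 : (0 : ℝ) ∈ Set.Ioo (-r) r := abs_lt.1 (by rw [abs_zero]; positivity)
  have hcompact : IsCompact (f '' Set.Icc (-r) r ∪ g '' Set.Icc (-r) r) :=
    (isCompact_Icc.image hfc).union (isCompact_Icc.image hgc)
  obtain ⟨K, hK⟩ :=
    hF.locallyLipschitz.locallyLipschitzOn.exists_lipschitzOnWith_of_compact hcompact
  exact ODE_solution_unique_of_mem_Icc (v := fun _ => F) (s := fun _ => _) (fun _ _ => hK) h0
    hfc.continuousOn (fun s _ => hf s)
    (fun s hs => Or.inl ⟨s, Set.Ioo_subset_Icc_self hs, rfl⟩)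
    hgc.continuousOn (fun s _ => hg s)
    (fun s hs => Or.inr ⟨s, Set.Ioo_subset_Icc_self hs, rfl⟩) h₀ ht

end MatrixCalculus

section Intertwining

variable {𝕜 m k : Type*} [RCLike 𝕜] [Fintype m] [DecidableEq m] [Fintype k] [DecidableEq k]

theorem exp_mul_eq_of_sylvester {X : Matrix m m 𝕜} {Y : Matrix k k 𝕜} {Z C : Matrix m k 𝕜}
    (hC : X * C = C * Y) (hZ : X * Z = Z * Y + C) : exp X * Z = (Z + C) * exp Y := by
  have hcomm (t : ℝ) : Y * exp (t • Y) = exp (t • Y) * Y :=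
    (((Commute.refl Y).smul_right t).exp_right).eq
  have hcancel (t : ℝ) : -X * (Z + t • C) + C + (Z + t • C) * Y = 0 := by
    simp only [Matrix.mul_add, Matrix.add_mul, Matrix.neg_mul, Matrix.mul_smul, Matrix.smul_mul,
      hC, hZ]
    module
  -- The curve `exp (-t X) (Z + t C) exp (t Y)` is constant.
  have hderiv (t : ℝ) :
      HasDerivAt (fun t : ℝ => exp (t • -X) * (Z + t • C) * exp (t • Y)) 0 t := by
    refine (hasDerivAt_matrix_mul (hasDerivAt_matrix_mul (hasDerivAt_matrix_exp_smul (-X) t)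
      (hasDerivAt_matrix_add_smul Z C t)) (hasDerivAt_matrix_exp_smul Y t)).congr_deriv ?_
    calc _ = exp (t • -X) * (-X * (Z + t • C) + C + (Z + t • C) * Y) * exp (t • Y) := by
          simp only [← hcomm, Matrix.mul_add, Matrix.add_mul, Matrix.mul_assoc]
      _ = 0 := by rw [hcancel, Matrix.mul_zero, Matrix.zero_mul]
  have hconst := is_const_of_deriv_eq_zero (fun t => (hderiv t).differentiableAt)
    (fun t => (hderiv t).deriv) 1 0
  simp only [one_smul, zero_smul, exp_zero, add_zero, Matrix.one_mul, Matrix.mul_one] at hconst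
  rw [Matrix.exp_neg, Matrix.mul_assoc] at hconst
  calc exp X * Z = exp X * ((exp X)⁻¹ * ((Z + C) * exp Y)) := by rw [hconst]
    _ = (Z + C) * exp Y := Matrix.mul_nonsing_inv_cancel_left _ _
        ((Matrix.isUnit_iff_isUnit_det _).1 (Matrix.isUnit_exp X))

theorem exp_mul_eq_mul_exp {X : Matrix m m 𝕜} {Y : Matrix k k 𝕜} {Z : Matrix m k 𝕜}
    (hZ : X * Z = Z * Y) : exp X * Z = Z * exp Y := by
  simpa only [add_zero] using
    exp_mul_eq_of_sylvester (X := X) (Y := Y) (C := 0) (by rw [Matrix.mul_zero, Matrix.zero_mul])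
      (by rw [hZ, add_zero])

end Intertwining

section PrincipalLog

section Spectrum

variable {K m k : Type*} [Fintype m] [DecidableEq m] [Fintype k] [DecidableEq k]

open Polynomial in
theorem aeval_mul_eq_mul_aeval {R : Type*} [CommRing R] {X : Matrix m m R} {Y : Matrix k k R}
    {Z : Matrix m k R} (h : X * Z = Z * Y) (q : R[X]) : aeval X q * Z = Z * aeval Y q := by
  have hpow (i : ℕ) : X ^ i * Z = Z * Y ^ i := by
    induction i with
    | zero => rw [pow_zero, pow_zero, Matrix.one_mul, Matrix.mul_one]
    | succ i ih => rw [pow_succ, Matrix.mul_assoc, h, ← Matrix.mul_assoc, ih, Matrix.mul_assoc,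
        ← pow_succ]
  induction q using Polynomial.induction_on' with
  | add q r hq hr => simp only [map_add, Matrix.add_mul, Matrix.mul_add, hq, hr]
  | monomial i a =>
    simp only [aeval_monomial, ← Algebra.smul_def, Matrix.smul_mul, Matrix.mul_smul, hpow]

variable [Field K] [IsAlgClosed K]

theorem exists_mem_spectrum_of_mul_eq_mul {X : Matrix m m K} {Y : Matrix k k K}
    {Z : Matrix m k K} (hZ : Z ≠ 0) (h : X * Z = Z * Y) : ∃ a ∈ spectrum K X, a ∈ spectrum K Y := by
  have : Nonempty m := not_isEmpty_iff.1 fun _ => hZ (Subsingleton.elim _ _)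
  have hcharpoly : Polynomial.aeval X Y.charpoly * Z = 0 := by
    rw [aeval_mul_eq_mul_aeval h, Matrix.aeval_self_charpoly, Matrix.mul_zero]
  have hmem : (0 : K) ∈ spectrum K (Polynomial.aeval X Y.charpoly) := by
    rw [spectrum.zero_mem_iff, Matrix.isUnit_iff_isUnit_det]
    intro hunit
    exact hZ (by rw [← Matrix.nonsing_inv_mul_cancel_left _ Z hunit, hcharpoly, Matrix.mul_zero])
  rw [spectrum.map_polynomial_aeval_of_nonempty _ _
    (spectrum.nonempty_of_isAlgClosed_of_finiteDimensional K X)] at hmem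
  obtain ⟨a, haX, haY⟩ := hmem
  exact ⟨a, haX, Matrix.mem_spectrum_iff_isRoot_charpoly.2 haY⟩

theorem apply_eq_zero_of_mem_invariant {V : Type*} [AddCommGroup V] [Module K V]
    [FiniteDimensional K V] {T : Module.End K V} {S : Submodule K V} (hS : ∀ v ∈ S, T v ∈ S)
    (heigen : ∀ v ∈ S, ∀ l : K, v ≠ 0 → T v = l • v → l = 0)
    (hker : ∀ v ∈ S, T (T v) = 0 → T v = 0) {v : V} (hv : v ∈ S) : T v = 0 := by
  by_contra hTv
  have hinv : ∀ w ∈ S.map T, T w ∈ S.map T := by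
    rintro _ ⟨w, hw, rfl⟩
    exact Submodule.mem_map_of_mem (hS w hw)
  have : Nontrivial (S.map T) :=
    ⟨⟨T v, Submodule.mem_map_of_mem hv⟩, 0, fun h => hTv (congrArg Subtype.val h)⟩
  obtain ⟨l, hl⟩ := Module.End.exists_eigenvalue (T.restrict hinv)
  obtain ⟨⟨_, w, hw, rfl⟩, hvec⟩ := hl.exists_hasEigenvector
  have hTw : T (T w) = l • T w := congrArg Subtype.val hvec.apply_eq_smul
  have hne : T w ≠ 0 := fun h => hvec.2 (Subtype.ext h)
  rw [heigen _ (hS w hw) l hne hTw, zero_smul] at hTw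
  exact hne (hker w hw hTw)

end Spectrum

variable {m k : Type*} [Fintype k] [DecidableEq k]

theorem eq_zero_of_mul_exp_eq_zero {Z : Matrix m k ℂ} {Y : Matrix k k ℂ} (h : Z * exp Y = 0) :
    Z = 0 := by
  rw [← Matrix.mul_nonsing_inv_cancel_right _ Z
    ((Matrix.isUnit_iff_isUnit_det _).1 (Matrix.isUnit_exp Y)), h, Matrix.zero_mul]

theorem exp_add_smul_one (Y : Matrix k k ℂ) (l : ℂ) :
    exp (Y + l • (1 : Matrix k k ℂ)) = Complex.exp l • exp Y := by
  rw [Matrix.exp_add_of_commute _ _ ((Commute.one_right Y).smul_right l),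
    Matrix.smul_one_eq_diagonal, Matrix.exp_diagonal, Complex.exp_eq_exp_ℂ, Pi.exp_def,
    ← Matrix.smul_one_eq_diagonal, Matrix.mul_smul, Matrix.mul_one]

variable [Fintype m] [DecidableEq m] {X : Matrix m m ℂ} {Y : Matrix k k ℂ} {Z : Matrix m k ℂ}

theorem eq_zero_of_sylvester_eigenvector (hX : ∀ z ∈ spectrum ℂ X, |z.im| < Real.pi)
    (hY : ∀ z ∈ spectrum ℂ Y, |z.im| < Real.pi) (hexp : exp X * Z = Z * exp Y) (hZ : Z ≠ 0)
    {l : ℂ} (h : X * Z - Z * Y = l • Z) : l = 0 := by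
  have hshift : X * Z = Z * (Y + l • (1 : Matrix k k ℂ)) := by
    rw [Matrix.mul_add, Matrix.mul_smul, Matrix.mul_one, ← h, add_sub_cancel]
  obtain ⟨a, haX, haY⟩ := exists_mem_spectrum_of_mul_eq_mul hZ hshift
  have hbY : a - l ∈ spectrum ℂ Y := by
    rw [← Algebra.algebraMap_eq_smul_one, ← spectrum.add_singleton_eq] at haY
    obtain ⟨b, hb, _, rfl, rfl⟩ := haY
    rwa [add_sub_cancel_right]
  have hexpl : Complex.exp l = 1 := by
    have hmul : Z * exp Y = Complex.exp l • (Z * exp Y) := by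
      rw [← Matrix.mul_smul, ← exp_add_smul_one, ← exp_mul_eq_mul_exp hshift, hexp]
    have hsmul : (Complex.exp l - 1) • (Z * exp Y) = 0 := by
      rw [sub_smul, ← hmul, one_smul, sub_self]
    exact sub_eq_zero.1 ((smul_eq_zero.1 hsmul).resolve_right (mt eq_zero_of_mul_exp_eq_zero hZ))
  have hab : a = a - l :=
    Complex.exp_inj_of_neg_pi_lt_of_le_pi (abs_lt.1 (hX a haX)).1 (abs_lt.1 (hX a haX)).2.le
      (abs_lt.1 (hY _ hbY)).1 (abs_lt.1 (hY _ hbY)).2.le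
      (by rw [Complex.exp_sub, hexpl, div_one])
  exact sub_eq_self.1 hab.symm

theorem mul_eq_mul_of_exp_mul_eq_mul_exp (hX : ∀ z ∈ spectrum ℂ X, |z.im| < Real.pi)
    (hY : ∀ z ∈ spectrum ℂ Y, |z.im| < Real.pi) (h : exp X * Z = Z * exp Y) :
    X * Z = Z * Y := by
  let sylvester : Module.End ℂ (Matrix m k ℂ) :=
    mulLeftLinearMap k ℂ X - mulRightLinearMap m ℂ Y
  let intertwiners : Submodule ℂ (Matrix m k ℂ) :=
    LinearMap.eqLocus (mulLeftLinearMap k ℂ (exp X)) (mulRightLinearMap m ℂ (exp Y))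
  have hinv : ∀ Z ∈ intertwiners, sylvester Z ∈ intertwiners := by
    intro Z (hZ : exp X * Z = Z * exp Y)
    have hXcomm : exp X * X = X * exp X := exp_mul_eq_mul_exp rfl
    have hYcomm : exp Y * Y = Y * exp Y := exp_mul_eq_mul_exp rfl
    change exp X * (X * Z - Z * Y) = (X * Z - Z * Y) * exp Y
    rw [Matrix.mul_sub, Matrix.sub_mul, ← Matrix.mul_assoc, hXcomm, Matrix.mul_assoc, hZ,
      ← Matrix.mul_assoc (exp X), hZ, Matrix.mul_assoc Z, hYcomm]
    simp only [Matrix.mul_assoc]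
  have hker : ∀ Z ∈ intertwiners, sylvester (sylvester Z) = 0 → sylvester Z = 0 := by
    intro Z (hZ : exp X * Z = Z * exp Y) hTT
    have hsum := exp_mul_eq_of_sylvester (sub_eq_zero.1 hTT) (add_sub_cancel (Z * Y) (X * Z)).symm
    rw [hZ, Matrix.add_mul, left_eq_add] at hsum
    exact eq_zero_of_mul_exp_eq_zero hsum
  exact sub_eq_zero.1 (apply_eq_zero_of_mem_invariant hinv
    (fun Z hZ _ hne hl => eq_zero_of_sylvester_eigenvector hX hY hZ hne hl) hker h)

end PrincipalLog

section RealPrincipalLog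

variable {m : Type*} [Fintype m] [DecidableEq m]

theorem exp_map_ofReal (L : Matrix m m ℝ) :
    exp (L.map Complex.ofReal) = (exp L).map Complex.ofReal :=
  (@map_exp (Matrix m m ℝ) (Matrix m m ℂ) Matrix.linftyOpNormedRing
    Matrix.linftyOpNormedAlgebra (inferInstanceAs (CompleteSpace (m → m → ℝ)))
    Matrix.linftyOpNormedRing Matrix.instAlgebra _ RingHom.instFunLike RingHom.instRingHomClass
    Complex.ofRealHom.mapMatrix
    (Continuous.matrix_map continuous_id Complex.continuous_ofReal) L).symm

namespace IsPrincipalLog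

variable {V L L' : Matrix m m ℝ}

theorem unique (h : IsPrincipalLog V L) (h' : IsPrincipalLog V L') : L = L' := by
  refine Matrix.map_injective Complex.ofReal_injective ?_
  have hone : exp (L.map Complex.ofReal) * 1 = 1 * exp (L'.map Complex.ofReal) := by
    rw [exp_map_ofReal, exp_map_ofReal, h.1, h'.1, mul_one, one_mul]
  simpa only [mul_one, one_mul] using mul_eq_mul_of_exp_mul_eq_mul_exp h.2 h'.2 hone

theorem transpose (h : IsPrincipalLog V L) : IsPrincipalLog Vᵀ Lᵀ := by
  refine ⟨by rw [Matrix.exp_transpose, h.1], fun z hz => h.2 z ?_⟩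
  rwa [Matrix.transpose_map, Matrix.mem_spectrum_iff_isRoot_charpoly, Matrix.charpoly_transpose,
    ← Matrix.mem_spectrum_iff_isRoot_charpoly] at hz

theorem inv (h : IsPrincipalLog V L) : IsPrincipalLog V⁻¹ (-L) := by
  refine ⟨by rw [Matrix.exp_neg, h.1], fun z hz => ?_⟩
  have hneg : (-L).map Complex.ofReal = -L.map Complex.ofReal :=
    Matrix.map_neg Complex.ofReal Complex.ofReal_neg L
  rw [hneg, ← spectrum.neg_eq, Set.mem_neg] at hz
  simpa only [Complex.neg_im, abs_neg] using h.2 (-z) hz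

theorem transpose_eq_neg (h : IsPrincipalLog V L) (hV : V ∈ Matrix.orthogonalGroup m ℝ) :
    Lᵀ = -L := by
  have hVinv : V⁻¹ = Vᵀ := Matrix.inv_eq_left_inv ((Matrix.mem_orthogonalGroup_iff' m ℝ).1 hV)
  exact h.transpose.unique (hVinv ▸ h.inv)

end IsPrincipalLog

end RealPrincipalLog

section SkewEstimate

variable {m k : Type*} [Fintype m] [Fintype k]

theorem ofReal_trace_transpose_mul_self (X : Matrix m k ℝ) :
    ((Xᵀ * X).trace : ℂ) = ((X.map Complex.ofReal)ᴴ * X.map Complex.ofReal).trace := by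
  simp [Matrix.trace, Matrix.mul_apply]

variable [DecidableEq m]

theorem sq_le_mul_norm_exp_sub_one_sq {θ : ℝ} (hθ : |θ| ≤ Real.pi) :
    θ ^ 2 ≤ Real.pi ^ 2 / 4 * ‖Complex.exp (Complex.I * θ) - 1‖ ^ 2 := by
  have hhalf : |θ / 2| ≤ Real.pi / 2 := by rw [abs_div, abs_two]; linarith
  have hsin : |θ| ≤ Real.pi * |Real.sin (θ / 2)| := by
    calc |θ| = Real.pi * (2 / Real.pi * |θ / 2|) := by
          rw [abs_div, abs_two]; field_simp
      _ ≤ Real.pi * |Real.sin (θ / 2)| := by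
          gcongr; exact Real.mul_abs_le_abs_sin hhalf
  calc θ ^ 2 = |θ| ^ 2 := (sq_abs θ).symm
    _ ≤ (Real.pi * |Real.sin (θ / 2)|) ^ 2 := by gcongr
    _ = Real.pi ^ 2 / 4 * ‖Complex.exp (Complex.I * θ) - 1‖ ^ 2 := by
      rw [Complex.norm_exp_I_mul_ofReal_sub_one, Real.norm_eq_abs, abs_mul, abs_two]
      ring

theorem exists_eq_conj_diagonal {L : Matrix m m ℂ} (hL : Lᴴ = -L) :
    ∃ (P : Matrix.unitaryGroup m ℂ) (θ : m → ℝ),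
      L = Unitary.conjStarAlgAut ℂ _ P (Matrix.diagonal fun i => Complex.I * θ i) := by
  have hherm : (-Complex.I • L).IsHermitian := by
    rw [Matrix.IsHermitian, Matrix.conjTranspose_smul, hL]
    simp
  refine ⟨hherm.eigenvectorUnitary, hherm.eigenvalues, ?_⟩
  have hdiag : (Matrix.diagonal fun i => Complex.I * (hherm.eigenvalues i : ℂ)) =
      Complex.I • Matrix.diagonal (RCLike.ofReal ∘ hherm.eigenvalues) := by
    rw [← Matrix.diagonal_smul]; rfl
  rw [hdiag, map_smul, ← hherm.spectral_theorem, smul_smul]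
  simp

theorem exp_conjStarAlgAut_diagonal (P : Matrix.unitaryGroup m ℂ) (d : m → ℂ) :
    exp (Unitary.conjStarAlgAut ℂ _ P (Matrix.diagonal d)) =
      Unitary.conjStarAlgAut ℂ _ P (Matrix.diagonal fun i => Complex.exp (d i)) := by
  have hinv : (P : Matrix m m ℂ)⁻¹ = star (P : Matrix m m ℂ) :=
    Matrix.inv_eq_left_inv (Unitary.coe_star_mul_self P)
  rw [Unitary.conjStarAlgAut_apply, Unitary.conjStarAlgAut_apply, ← hinv,
    Matrix.exp_conj _ _ (Unitary.isUnit_coe (U := P)), Matrix.exp_diagonal, Pi.exp_def,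
    Complex.exp_eq_exp_ℂ]

open scoped ComplexOrder

theorem posSemidef_exp_sub_one_of_conjTranspose_eq_neg {L : Matrix m m ℂ} (hL : Lᴴ = -L)
    (hspec : ∀ z ∈ spectrum ℂ L, |z.im| ≤ Real.pi) :
    (((Real.pi ^ 2 / 4 : ℝ) : ℂ) • ((exp L - 1)ᴴ * (exp L - 1)) - Lᴴ * L).PosSemidef := by
  obtain ⟨P, θ, rfl⟩ := exists_eq_conj_diagonal hL
  set φ := Unitary.conjStarAlgAut ℂ (Matrix m m ℂ) P with hφ
  have hθ (i : m) : |θ i| ≤ Real.pi := by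
    simpa using hspec (Complex.I * θ i) (by simp)
  set D := Matrix.diagonal fun i => Complex.I * θ i with hD
  set E := Matrix.diagonal fun i => Complex.exp (Complex.I * θ i) - 1 with hE
  have hexp : exp (φ D) - 1 = φ E := by
    rw [exp_conjStarAlgAut_diagonal, ← map_one φ, ← map_sub, ← Matrix.diagonal_one,
      Matrix.diagonal_sub]
  have hdiag : ((Real.pi ^ 2 / 4 : ℝ) : ℂ) • (star E * E) - star D * D =
      Matrix.diagonal fun i => ((Real.pi ^ 2 / 4 *
        ‖Complex.exp (Complex.I * θ i) - 1‖ ^ 2 - θ i ^ 2 : ℝ) : ℂ) := by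
    simp only [hD, hE, Matrix.star_eq_conjTranspose, Matrix.diagonal_conjTranspose,
      Matrix.diagonal_mul_diagonal, ← Matrix.diagonal_smul, Matrix.diagonal_sub]
    congr 1
    ext i
    simp only [Pi.smul_apply, Pi.star_apply, RCLike.star_def, Complex.conj_mul', smul_eq_mul,
      norm_mul, Complex.norm_I, one_mul, Complex.norm_real, Real.norm_eq_abs]
    rw [← Complex.ofReal_pow |θ i|, sq_abs]
    push_cast
    rfl
  have hconj : ((Real.pi ^ 2 / 4 : ℝ) : ℂ) • ((φ E)ᴴ * φ E) - (φ D)ᴴ * φ D =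
      φ (((Real.pi ^ 2 / 4 : ℝ) : ℂ) • (star E * E) - star D * D) := by
    simp only [← Matrix.star_eq_conjTranspose, map_sub, map_smul, map_mul, map_star]
  rw [hexp, hconj, hdiag, hφ, Unitary.conjStarAlgAut_apply]
  refine Matrix.PosSemidef.mul_mul_conjTranspose_same
    (Matrix.posSemidef_diagonal_iff.2 fun i => ?_) (P : Matrix m m ℂ)
  exact Complex.zero_le_real.2 (sub_nonneg.2 (sq_le_mul_norm_exp_sub_one_sq (hθ i)))

theorem trace_mul_le_trace_exp_sub_one_mul {L : Matrix m m ℝ} (hL : Lᵀ = -L)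
    (hspec : ∀ z ∈ spectrum ℂ (L.map Complex.ofReal), |z.im| ≤ Real.pi) (Z : Matrix m k ℝ) :
    ((L * Z)ᵀ * (L * Z)).trace ≤
      Real.pi ^ 2 / 4 * (((exp L - 1) * Z)ᵀ * ((exp L - 1) * Z)).trace := by
  have hLc : (L.map Complex.ofReal)ᴴ = -L.map Complex.ofReal := by
    rw [← Matrix.map_neg Complex.ofReal Complex.ofReal_neg, ← hL]
    ext i j
    simp
  have hmul (X : Matrix m m ℝ) :
      (X * Z).map Complex.ofReal = X.map Complex.ofReal * Z.map Complex.ofReal :=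
    Matrix.map_mul (f := Complex.ofRealHom)
  have hexp : (exp L - 1).map Complex.ofReal = exp (L.map Complex.ofReal) - 1 := by
    rw [exp_map_ofReal, Matrix.map_sub Complex.ofReal Complex.ofReal_sub,
      Matrix.map_one Complex.ofReal Complex.ofReal_zero Complex.ofReal_one]
  have hpos := ((posSemidef_exp_sub_one_of_conjTranspose_eq_neg hLc
    hspec).conjTranspose_mul_mul_same (Z.map Complex.ofReal)).trace_nonneg
  rw [← hexp] at hpos
  rw [← sub_nonneg, ← Complex.zero_le_real]
  refine hpos.trans_eq ?_
  rw [Complex.ofReal_sub, Complex.ofReal_mul, ofReal_trace_transpose_mul_self,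
    ofReal_trace_transpose_mul_self, hmul, hmul]
  simp only [Matrix.conjTranspose_mul, Matrix.mul_sub, Matrix.sub_mul, Matrix.mul_smul,
    Matrix.smul_mul, Matrix.trace_sub, Matrix.trace_smul, smul_eq_mul, Matrix.mul_assoc]

end SkewEstimate

section Geodesic

variable {n p : ℕ} {x v w ξ : Matrix (Fin n) (Fin p) ℝ} {γ : ℝ → Matrix (Fin n) (Fin p) ℝ} {t : ℝ}

theorem metric_eq (x v ξ : Matrix (Fin n) (Fin p) ℝ) :
    metric x v ξ = (vᵀ * ξ).trace - (1 / 2 : ℝ) * (vᵀ * (x * (xᵀ * ξ))).trace := by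
  simp [metric, Matrix.mul_sub, Matrix.sub_mul, Matrix.mul_assoc]

theorem metric_sub_left (x v w ξ : Matrix (Fin n) (Fin p) ℝ) :
    metric x (v - w) ξ = metric x v ξ - metric x w ξ := by
  simp only [metric, Matrix.transpose_sub, Matrix.sub_mul, Matrix.trace_sub]

theorem hasDerivAt_metric {x v : ℝ → Matrix (Fin n) (Fin p) ℝ}
    {x' v' : Matrix (Fin n) (Fin p) ℝ} (hx : HasDerivAt x x' t) (hv : HasDerivAt v v' t)
    (ξ : Matrix (Fin n) (Fin p) ℝ) :
    HasDerivAt (fun s => metric (x s) (v s) ξ)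
      (metric (x t) v' ξ - (1 / 2 : ℝ) *
        ((v t)ᵀ * (x' * ((x t)ᵀ * ξ)) + (v t)ᵀ * (x t * (x'ᵀ * ξ))).trace) t := by
  simp only [metric_eq]
  have hξ := hasDerivAt_const t ξ
  have hvξ := hasDerivAt_matrix_trace (hasDerivAt_matrix_mul (hasDerivAt_matrix_transpose hv) hξ)
  have hvxξ := hasDerivAt_matrix_trace (hasDerivAt_matrix_mul (hasDerivAt_matrix_transpose hv)
    (hasDerivAt_matrix_mul hx (hasDerivAt_matrix_mul (hasDerivAt_matrix_transpose hx) hξ)))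
  refine (hvξ.sub (hvxξ.const_mul (1 / 2 : ℝ))).congr_deriv ?_
  simp only [Matrix.mul_zero, add_zero, Matrix.trace_add, Matrix.mul_add]
  ring

theorem hasDerivAt_energy (x v ξ : Matrix (Fin n) (Fin p) ℝ) :
    HasDerivAt (fun s : ℝ => (1 / 2 : ℝ) * metric (x + s • ξ) v v)
      (-(1 / 2 : ℝ) * (vᵀ * (ξ * (xᵀ * v))).trace) 0 := by
  refine ((hasDerivAt_metric (hasDerivAt_matrix_add_smul x ξ 0) (hasDerivAt_const 0 v)
    v).const_mul (1 / 2 : ℝ)).congr_deriv ?_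
  have hsymm : (vᵀ * (x * (ξᵀ * v))).trace = (vᵀ * (ξ * (xᵀ * v))).trace := by
    rw [← Matrix.trace_transpose]
    simp [Matrix.mul_assoc]
  simp only [metric_eq, zero_smul, add_zero, Matrix.transpose_zero, Matrix.zero_mul,
    Matrix.trace_zero, Matrix.trace_add, hsymm]
  ring

/-- The acceleration of the geodesic of the canonical metric through `x` with velocity `v`: the
geodesic equation is `γ'' = spray γ γ'`. -/
def spray (x v : Matrix (Fin n) (Fin p) ℝ) : Matrix (Fin n) (Fin p) ℝ :=
  v * (xᵀ * v) - x * (xᵀ * v * (xᵀ * v)) - x * (vᵀ * v)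

theorem contDiff_spray {r : WithTop ℕ∞} : ContDiff ℝ r
    fun z : Matrix (Fin n) (Fin p) ℝ × Matrix (Fin n) (Fin p) ℝ => spray z.1 z.2 := by
  have hxv := contDiff_matrix_mul (𝕜 := ℝ) (contDiff_matrix_transpose contDiff_fst)
    (contDiff_snd (𝕜 := ℝ) (n := r) (E := Matrix (Fin n) (Fin p) ℝ)
      (F := Matrix (Fin n) (Fin p) ℝ))
  exact ((contDiff_matrix_mul contDiff_snd hxv).sub
    (contDiff_matrix_mul contDiff_fst (contDiff_matrix_mul hxv hxv))).sub
    (contDiff_matrix_mul contDiff_fst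
      (contDiff_matrix_mul (contDiff_matrix_transpose contDiff_snd) contDiff_snd))

theorem transpose_mul_spray (hx : x ∈ St n p) (v : Matrix (Fin n) (Fin p) ℝ) :
    xᵀ * spray x v = -(vᵀ * v) := by
  have hx : xᵀ * x = 1 := hx
  simp only [spray, Matrix.mul_sub, ← Matrix.mul_assoc, hx, Matrix.one_mul]
  abel

theorem trace_symm_mul_skew {m R : Type*} [Fintype m] [CommRing R] [NoZeroDivisors R] [CharZero R]
    {S K : Matrix m m R} (hS : Sᵀ = S) (hK : Kᵀ = -K) : (S * K).trace = 0 := by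
  refine self_eq_neg.1 ?_
  conv_lhs => rw [← Matrix.trace_transpose, Matrix.transpose_mul, hS, hK, Matrix.neg_mul,
    Matrix.trace_neg, Matrix.trace_mul_comm]

theorem metric_spray (hx : x ∈ St n p) (hv : v ∈ tangent x) (hξ : ξ ∈ tangent x) :
    metric x (spray x v) ξ = (1 / 2 : ℝ) * (vᵀ * (v * (xᵀ * ξ)) + vᵀ * (x * (vᵀ * ξ))).trace -
      (1 / 2 : ℝ) * (vᵀ * (ξ * (xᵀ * v))).trace := by
  have hx : xᵀ * x = 1 := hx
  have hv : vᵀ * x = -(xᵀ * v) := (neg_eq_iff_eq_neg.2 hv).symm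
  have hξ : xᵀ * ξ = -(ξᵀ * x) := hξ
  have hxx (Z : Matrix (Fin p) (Fin p) ℝ) : xᵀ * (x * Z) = Z := by
    rw [← Matrix.mul_assoc, hx, Matrix.one_mul]
  have hvx (Z : Matrix (Fin p) (Fin p) ℝ) : vᵀ * (x * Z) = -(xᵀ * (v * Z)) := by
    rw [← Matrix.mul_assoc, hv, Matrix.neg_mul, Matrix.mul_assoc]
  have hsymm := trace_symm_mul_skew (S := xᵀ * v * (xᵀ * v) + vᵀ * v) (K := xᵀ * ξ)
    (by simp [hv]) (by rw [Matrix.transpose_mul, Matrix.transpose_transpose, hξ, neg_neg])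
  have hcycle : (vᵀ * (ξ * (xᵀ * v))).trace = (xᵀ * (v * (vᵀ * ξ))).trace := by
    rw [← Matrix.mul_assoc, Matrix.trace_mul_comm, Matrix.mul_assoc]
  rw [metric_eq, hcycle]
  simp only [spray, Matrix.transpose_sub, Matrix.transpose_mul, Matrix.transpose_transpose,
    Matrix.sub_mul, Matrix.mul_assoc, hv, hvx, hxx, Matrix.neg_mul, Matrix.mul_neg, neg_neg,
    Matrix.trace_sub, Matrix.trace_add, Matrix.trace_neg, Matrix.add_mul] at hsymm ⊢
  linarith

theorem eulerLagrange_iff_metric_sub_spray_eq_zero {v : ℝ → Matrix (Fin n) (Fin p) ℝ}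
    {a : Matrix (Fin n) (Fin p) ℝ} (hmem : γ t ∈ St n p) (hγ : HasDerivAt γ (v t) t)
    (hv : HasDerivAt v a t) (hvt : v t ∈ tangent (γ t)) (hξ : ξ ∈ tangent (γ t)) :
    deriv (fun s => metric (γ s) (v s) ξ) t =
        deriv (fun s : ℝ => (1 / 2 : ℝ) * metric (γ t + s • ξ) (v t) (v t)) 0 ↔
      metric (γ t) (a - spray (γ t) (v t)) ξ = 0 := by
  rw [(hasDerivAt_metric hγ hv ξ).deriv, (hasDerivAt_energy _ _ _).deriv, metric_sub_left,
    metric_spray hmem hvt hξ]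
  constructor <;> intro h <;> linarith

theorem eq_zero_of_forall_metric_eq_zero (hx : x ∈ St n p) (hw : w ∈ tangent x)
    (h : ∀ ξ ∈ tangent x, metric x w ξ = 0) : w = 0 := by
  have hx : xᵀ * x = 1 := hx
  have hxw (Z : Matrix (Fin p) (Fin p) ℝ) : xᵀ * (x * Z) = Z := by
    rw [← Matrix.mul_assoc, hx, Matrix.one_mul]
  have hwx : wᵀ * x = -(xᵀ * w) := (neg_eq_iff_eq_neg.2 hw).symm
  -- `w + x xᵀ w` is dual to `w`: the metric pairs it with `w` to the squared Frobenius norm.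
  have htangent : w + x * (xᵀ * w) ∈ tangent x := by
    change xᵀ * (w + x * (xᵀ * w)) = -((w + x * (xᵀ * w))ᵀ * x)
    simp [Matrix.add_mul, Matrix.mul_add, Matrix.mul_assoc, hx, hwx, hxw]
  have hnorm : metric x w (w + x * (xᵀ * w)) = (wᵀ * w).trace := by
    simp only [metric_eq, Matrix.mul_add, hxw, Matrix.trace_add]
    ring
  rw [← Matrix.trace_conjTranspose_mul_self_eq_zero_iff,
    Matrix.conjTranspose_eq_transpose_of_trivial, ← hnorm, h _ htangent]

theorem mem_tangent_of_hasDerivAt (hmem : ∀ s, γ s ∈ St n p) (hγ : HasDerivAt γ v t) :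
    v ∈ tangent (γ t) := by
  have hderiv := hasDerivAt_matrix_mul (hasDerivAt_matrix_transpose hγ) hγ
  rw [funext hmem] at hderiv
  exact eq_neg_of_add_eq_zero_right (hderiv.unique (hasDerivAt_const t _))

theorem sub_spray_mem_tangent {v : ℝ → Matrix (Fin n) (Fin p) ℝ} {a : Matrix (Fin n) (Fin p) ℝ}
    (hmem : ∀ s, γ s ∈ St n p) (hγ : ∀ s, HasDerivAt γ (v s) s) (hv : HasDerivAt v a t) :
    a - spray (γ t) (v t) ∈ tangent (γ t) := by
  have hderiv := (hasDerivAt_matrix_mul (hasDerivAt_matrix_transpose (hγ t)) hv).add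
    (hasDerivAt_matrix_mul (hasDerivAt_matrix_transpose hv) (hγ t))
  have hconst : ((fun s => (γ s)ᵀ * v s) + fun s => (v s)ᵀ * γ s) = fun _ => 0 :=
    funext fun s => eq_neg_iff_add_eq_zero.1 (mem_tangent_of_hasDerivAt hmem (hγ s))
  rw [hconst] at hderiv
  have hzero := hderiv.unique (hasDerivAt_const t 0)
  have hspray := transpose_mul_spray (hmem t) (v t)
  have hspray' : (spray (γ t) (v t))ᵀ * γ t = -((v t)ᵀ * v t) := by
    simpa using congrArg Matrix.transpose hspray
  change (γ t)ᵀ * (a - spray (γ t) (v t)) = -((a - spray (γ t) (v t))ᵀ * γ t)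
  rw [← add_eq_zero_iff_eq_neg, Matrix.mul_sub, Matrix.transpose_sub, Matrix.sub_mul, hspray,
    hspray', ← hzero]
  abel

theorem isGeodesic_iff_hasDerivAt_deriv : IsGeodesic γ ↔
    ContDiff ℝ ∞ γ ∧ (∀ t, γ t ∈ St n p) ∧
      ∀ t, HasDerivAt (deriv γ) (spray (γ t) (deriv γ t)) t := by
  have hasDeriv {f : ℝ → Matrix (Fin n) (Fin p) ℝ} (hf : ContDiff ℝ ∞ f) (t : ℝ) :
      HasDerivAt f (deriv f t) t := (hf.differentiable (by simp) t).hasDerivAt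
  constructor
  · intro h
    refine ⟨h.smooth, h.mem, fun t => ?_⟩
    have hγ := hasDeriv h.smooth
    have ha := hasDeriv (contDiff_infty_iff_deriv.1 h.smooth).2 t
    have hsub := eq_zero_of_forall_metric_eq_zero (h.mem t) (sub_spray_mem_tangent h.mem hγ ha)
      fun ξ hξ => (eulerLagrange_iff_metric_sub_spray_eq_zero (h.mem t) (hγ t) ha
        (mem_tangent_of_hasDerivAt h.mem (hγ t)) hξ).1 (h.eulerLagrange t ξ hξ)
    exact ha.congr_deriv (sub_eq_zero.1 hsub)
  · rintro ⟨hsmooth, hmem, hspray⟩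
    refine ⟨hsmooth, hmem, fun t ξ hξ => ?_⟩
    have hγ := hasDeriv hsmooth t
    rw [eulerLagrange_iff_metric_sub_spray_eq_zero (hmem t) hγ (hspray t)
      (mem_tangent_of_hasDerivAt hmem hγ) hξ]
    simp [metric]

namespace IsGeodesic

variable {δ : ℝ → Matrix (Fin n) (Fin p) ℝ}

theorem hasDerivAt_prodMk_deriv (hγ : IsGeodesic γ) (t : ℝ) :
    HasDerivAt (fun s => (γ s, deriv γ s)) (deriv γ t, spray (γ t) (deriv γ t)) t :=
  (hγ.smooth.differentiable (by simp) t).hasDerivAt.prodMk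
    ((isGeodesic_iff_hasDerivAt_deriv.1 hγ).2.2 t)

theorem eq_of_deriv_eq (hγ : IsGeodesic γ) (hδ : IsGeodesic δ) (h₀ : γ 0 = δ 0)
    (h₁ : deriv γ 0 = deriv δ 0) : γ = δ := by
  have hlift := eq_of_hasDerivAt_autonomous
    (F := fun z : Matrix (Fin n) (Fin p) ℝ × Matrix (Fin n) (Fin p) ℝ => (z.2, spray z.1 z.2))
    (contDiff_snd.prodMk contDiff_spray) hγ.hasDerivAt_prodMk_deriv hδ.hasDerivAt_prodMk_deriv
    (Prod.ext h₀ h₁)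
  exact funext fun t => congrArg Prod.fst (congrFun hlift t)

theorem Exp_eq (hγ : IsGeodesic γ) : Exp (γ 0) (deriv γ 0) = γ 1 := by
  have hex : ∃ δ : ℝ → Matrix (Fin n) (Fin p) ℝ,
      IsGeodesic δ ∧ δ 0 = γ 0 ∧ deriv δ 0 = deriv γ 0 := ⟨γ, hγ, rfl, rfl⟩
  obtain ⟨hδ, h₀, h₁⟩ := hex.choose_spec
  rw [Exp, dif_pos hex, hδ.eq_of_deriv_eq hγ h₀ h₁]

end IsGeodesic

end Geodesic

section ClosedForm

variable {n p : ℕ} {U K : Matrix (Fin n) (Fin p) ℝ} {A : Matrix (Fin p) (Fin p) ℝ}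

theorem hasDerivAt_toCols₁ {l m₁ m₂ : Type*} [Finite m₁] [Finite m₂]
    {f : ℝ → Matrix l (m₁ ⊕ m₂) ℝ} {f' : Matrix l (m₁ ⊕ m₂) ℝ} {t : ℝ} (hf : HasDerivAt f f' t) :
    HasDerivAt (fun s => (f s).toCols₁) f'.toCols₁ t := by
  have := Fintype.ofFinite m₁
  have := Fintype.ofFinite m₂
  exact hasDerivAt_pi.2 fun i => hasDerivAt_pi.2 fun j =>
    hasDerivAt_pi.1 (hasDerivAt_pi.1 hf i) (Sum.inl j)

theorem hasDerivAt_toCols₂ {l m₁ m₂ : Type*} [Finite m₁] [Finite m₂]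
    {f : ℝ → Matrix l (m₁ ⊕ m₂) ℝ} {f' : Matrix l (m₁ ⊕ m₂) ℝ} {t : ℝ} (hf : HasDerivAt f f' t) :
    HasDerivAt (fun s => (f s).toCols₂) f'.toCols₂ t := by
  have := Fintype.ofFinite m₁
  have := Fintype.ofFinite m₂
  exact hasDerivAt_pi.2 fun i => hasDerivAt_pi.2 fun j =>
    hasDerivAt_pi.1 (hasDerivAt_pi.1 hf i) (Sum.inr j)

theorem contDiff_toCols₁ {l m₁ m₂ : Type*} [Fintype l] [Fintype m₁] [Fintype m₂]
    {f : ℝ → Matrix l (m₁ ⊕ m₂) ℝ} {r : WithTop ℕ∞} (hf : ContDiff ℝ r f) :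
    ContDiff ℝ r fun s => (f s).toCols₁ :=
  contDiff_pi.2 fun i => contDiff_pi.2 fun j => contDiff_pi.1 (contDiff_pi.1 hf i) (Sum.inl j)

/-- The matrix `(A, -S; 1, 0)` driving the linear system `γ' = γ A + κ`, `κ' = -γ S` to which the
geodesic equation reduces, `S` being the (constant) Gram matrix of `κ`. -/
def geodesicGenerator {m : Type*} [DecidableEq m] (A S : Matrix m m ℝ) : Matrix (m ⊕ m) (m ⊕ m) ℝ :=
  Matrix.fromBlocks A (-S) 1 0

/-- The solution `(γ κ)` of the linear system driven by `geodesicGenerator A (Kᵀ K)` which starts at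
`(U K)`. -/
noncomputable def geodesicFrame (U : Matrix (Fin n) (Fin p) ℝ) (A : Matrix (Fin p) (Fin p) ℝ)
    (K : Matrix (Fin n) (Fin p) ℝ) (t : ℝ) : Matrix (Fin n) (Fin p ⊕ Fin p) ℝ :=
  Matrix.fromCols U K * exp (t • geodesicGenerator A (Kᵀ * K))

/-- The candidate for the geodesic through `U` with velocity `U A + K`: the first block column of
`geodesicFrame U A K`. -/
noncomputable def geodesicCurve (U : Matrix (Fin n) (Fin p) ℝ) (A : Matrix (Fin p) (Fin p) ℝ)
    (K : Matrix (Fin n) (Fin p) ℝ) (t : ℝ) : Matrix (Fin n) (Fin p) ℝ :=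
  (geodesicFrame U A K t).toCols₁

/-- The component of the velocity of `geodesicCurve U A K` normal to the column space of the curve:
the second block column of `geodesicFrame U A K`. -/
noncomputable def geodesicNormal (U : Matrix (Fin n) (Fin p) ℝ) (A : Matrix (Fin p) (Fin p) ℝ)
    (K : Matrix (Fin n) (Fin p) ℝ) (t : ℝ) : Matrix (Fin n) (Fin p) ℝ :=
  (geodesicFrame U A K t).toCols₂

theorem geodesicFrame_eq_fromCols (t : ℝ) :
    geodesicFrame U A K t = Matrix.fromCols (geodesicCurve U A K t) (geodesicNormal U A K t) :=
  (Matrix.fromCols_toCols _).symm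

theorem geodesicFrame_zero : geodesicFrame U A K 0 = Matrix.fromCols U K := by
  rw [geodesicFrame, zero_smul, exp_zero, Matrix.mul_one]

theorem hasDerivAt_geodesicFrame (t : ℝ) : HasDerivAt (geodesicFrame U A K)
    (geodesicFrame U A K t * geodesicGenerator A (Kᵀ * K)) t :=
  (hasDerivAt_matrix_mul (hasDerivAt_const t (Matrix.fromCols U K))
    (hasDerivAt_matrix_exp_smul (geodesicGenerator A (Kᵀ * K)) t)).congr_deriv <| by
      rw [Matrix.zero_mul, zero_add, geodesicFrame, Matrix.mul_assoc]

theorem geodesicFrame_mul_generator (t : ℝ) :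
    geodesicFrame U A K t * geodesicGenerator A (Kᵀ * K) =
      Matrix.fromCols (geodesicCurve U A K t * A + geodesicNormal U A K t)
        (-(geodesicCurve U A K t * (Kᵀ * K))) := by
  rw [geodesicFrame_eq_fromCols, geodesicGenerator, Matrix.fromCols_mul_fromBlocks,
    Matrix.mul_one, Matrix.mul_zero, add_zero, Matrix.mul_neg]

theorem hasDerivAt_geodesicCurve (t : ℝ) : HasDerivAt (geodesicCurve U A K)
    (geodesicCurve U A K t * A + geodesicNormal U A K t) t := by
  have hcols := hasDerivAt_toCols₁ (hasDerivAt_geodesicFrame (U := U) (A := A) (K := K) t)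
  rwa [geodesicFrame_mul_generator, Matrix.toCols₁_fromCols] at hcols

theorem hasDerivAt_geodesicNormal (t : ℝ) : HasDerivAt (geodesicNormal U A K)
    (-(geodesicCurve U A K t * (Kᵀ * K))) t := by
  have hcols := hasDerivAt_toCols₂ (hasDerivAt_geodesicFrame (U := U) (A := A) (K := K) t)
  rwa [geodesicFrame_mul_generator, Matrix.toCols₂_fromCols] at hcols

theorem contDiff_geodesicCurve : ContDiff ℝ ∞ (geodesicCurve U A K) :=
  contDiff_toCols₁ (contDiff_matrix_mul contDiff_const (contDiff_matrix_exp_smul _))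

theorem transpose_geodesicFrame_mul_self (hU : U ∈ St n p) (hA : Aᵀ = -A) (hK : Uᵀ * K = 0)
    (t : ℝ) : (geodesicFrame U A K t)ᵀ * geodesicFrame U A K t =
      Matrix.fromBlocks 1 0 0 (Kᵀ * K) := by
  have hU : Uᵀ * U = 1 := hU
  have hK' : Kᵀ * U = 0 := by simpa using congrArg Matrix.transpose hK
  set Γ := geodesicGenerator A (Kᵀ * K) with hΓ
  set G : Matrix (Fin p ⊕ Fin p) (Fin p ⊕ Fin p) ℝ := Matrix.fromBlocks 1 0 0 (Kᵀ * K) with hG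
  have hgram : (Matrix.fromCols U K)ᵀ * Matrix.fromCols U K = G := by
    rw [Matrix.transpose_fromCols, Matrix.fromRows_mul_fromCols, hU, hK, hK']
  have hskew : (t • Γ)ᵀ * G = G * -(t • Γ) := by
    rw [Matrix.transpose_smul, Matrix.smul_mul, ← smul_neg, Matrix.mul_smul]
    simp [hΓ, hG, geodesicGenerator, Matrix.fromBlocks_transpose, Matrix.fromBlocks_multiply,
      Matrix.fromBlocks_neg, hA]
  calc (geodesicFrame U A K t)ᵀ * geodesicFrame U A K t
      = exp (t • Γ)ᵀ * ((Matrix.fromCols U K)ᵀ * Matrix.fromCols U K) * exp (t • Γ) := by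
        rw [geodesicFrame, Matrix.transpose_mul, ← Matrix.exp_transpose]
        simp only [Matrix.mul_assoc, hΓ]
    _ = G * (exp (-(t • Γ)) * exp (t • Γ)) := by
        rw [hgram, exp_mul_eq_mul_exp hskew, Matrix.mul_assoc]
    _ = G := by
        rw [← Matrix.exp_add_of_commute _ _ (Commute.refl (t • Γ)).neg_left, neg_add_cancel,
          exp_zero, Matrix.mul_one]

theorem geodesicCurve_gram (hU : U ∈ St n p) (hA : Aᵀ = -A) (hK : Uᵀ * K = 0) (t : ℝ) :
    (geodesicCurve U A K t)ᵀ * geodesicCurve U A K t = 1 ∧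
      (geodesicCurve U A K t)ᵀ * geodesicNormal U A K t = 0 ∧
      (geodesicNormal U A K t)ᵀ * geodesicCurve U A K t = 0 ∧
      (geodesicNormal U A K t)ᵀ * geodesicNormal U A K t = Kᵀ * K := by
  rw [← Matrix.fromBlocks_inj, ← transpose_geodesicFrame_mul_self hU hA hK t,
    geodesicFrame_eq_fromCols, Matrix.transpose_fromCols, Matrix.fromRows_mul_fromCols]

theorem spray_mul_add {x κ : Matrix (Fin n) (Fin p) ℝ} (hx : x ∈ St n p) (hA : Aᵀ = -A)
    (hκ : xᵀ * κ = 0) : spray x (x * A + κ) = (x * A + κ) * A - x * (κᵀ * κ) := by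
  have hx : xᵀ * x = 1 := hx
  have hκ' : κᵀ * x = 0 := by simpa using congrArg Matrix.transpose hκ
  have hvel : xᵀ * (x * A + κ) = A := by
    rw [Matrix.mul_add, ← Matrix.mul_assoc, hx, hκ, Matrix.one_mul, add_zero]
  have hsq : (x * A + κ)ᵀ * (x * A + κ) = κᵀ * κ - A * A := by
    rw [Matrix.transpose_add, Matrix.add_mul, Matrix.transpose_mul, Matrix.mul_assoc, hvel,
      Matrix.mul_add, ← Matrix.mul_assoc, hκ', hA, Matrix.zero_mul, zero_add, Matrix.neg_mul]
    abel
  rw [spray, hvel, hsq, Matrix.mul_sub]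
  abel

theorem isGeodesic_geodesicCurve (hU : U ∈ St n p) (hA : Aᵀ = -A) (hK : Uᵀ * K = 0) :
    IsGeodesic (geodesicCurve U A K) := by
  have hgram := geodesicCurve_gram hU hA hK
  have hderiv : deriv (geodesicCurve U A K) =
      fun t => geodesicCurve U A K t * A + geodesicNormal U A K t :=
    funext fun t => (hasDerivAt_geodesicCurve t).deriv
  refine isGeodesic_iff_hasDerivAt_deriv.2
    ⟨contDiff_geodesicCurve, fun t => (hgram t).1, fun t => ?_⟩
  obtain ⟨hγ, hγκ, -, hκ⟩ := hgram t
  rw [hderiv, spray_mul_add hγ hA hγκ, hκ]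
  refine ((hasDerivAt_matrix_mul (hasDerivAt_geodesicCurve t) (hasDerivAt_const t A)).add
    (hasDerivAt_geodesicNormal t)).congr_deriv ?_
  rw [Matrix.mul_zero, add_zero, sub_eq_add_neg]

theorem Exp_mul_add (hU : U ∈ St n p) (hA : Aᵀ = -A) (hK : Uᵀ * K = 0) :
    Exp U (U * A + K) = geodesicCurve U A K 1 := by
  have h₀ : geodesicCurve U A K 0 = U := by
    rw [geodesicCurve, geodesicFrame_zero, Matrix.toCols₁_fromCols]
  have hκ₀ : geodesicNormal U A K 0 = K := by
    rw [geodesicNormal, geodesicFrame_zero, Matrix.toCols₂_fromCols]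
  have hderiv : deriv (geodesicCurve U A K) 0 = U * A + K :=
    (hasDerivAt_geodesicCurve 0).deriv.trans (by rw [h₀, hκ₀])
  rw [← (isGeodesic_geodesicCurve hU hA hK).Exp_eq, hderiv, h₀]

theorem Exp_mul_add_mul {m : Type*} [Fintype m] [DecidableEq m] {Q : Matrix (Fin n) m ℝ}
    {B N : Matrix m (Fin p) ℝ} {M : Matrix (Fin p) (Fin p) ℝ} {X : Matrix (Fin p) m ℝ}
    {Y : Matrix m m ℝ} (hU : U ∈ St n p) (hQ : Qᵀ * Q = 1) (hA : Aᵀ = -A)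
    (hQB : Uᵀ * (Q * B) = 0)
    (hexp : exp (Matrix.fromBlocks A (-Bᵀ) B 0) = Matrix.fromBlocks M X N Y) :
    Exp U (U * A + Q * B) = U * M + Q * N := by
  set L := Matrix.fromBlocks A (-Bᵀ) B (0 : Matrix m m ℝ)
  set J : Matrix (Fin p ⊕ m) (Fin p ⊕ Fin p) ℝ := Matrix.fromBlocks 1 0 0 B
  have hgram : (Q * B)ᵀ * (Q * B) = Bᵀ * B := by
    rw [Matrix.transpose_mul, Matrix.mul_assoc, ← Matrix.mul_assoc Qᵀ, hQ, Matrix.one_mul]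
  have hJ : L * J = J * geodesicGenerator A (Bᵀ * B) := by
    simp [L, J, geodesicGenerator, Matrix.fromBlocks_multiply]
  have hcols : Matrix.fromCols U (Q * B) = Matrix.fromCols U Q * J := by
    simp [J, Matrix.fromCols_mul_fromBlocks]
  have hframe : geodesicFrame U A (Q * B) 1 = Matrix.fromCols U Q * exp L * J := by
    rw [geodesicFrame, one_smul, hgram, hcols, Matrix.mul_assoc, ← exp_mul_eq_mul_exp hJ,
      Matrix.mul_assoc]
  rw [Exp_mul_add hU hA hQB, geodesicCurve, hframe, hexp]
  simp [J, Matrix.fromCols_mul_fromBlocks]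

end ClosedForm

section Solution

variable {n p : ℕ} {U W Q : Matrix (Fin n) (Fin p) ℝ} {𝒱 : Set (Matrix (Fin n) (Fin p) ℝ)}

theorem transpose_mul_self_mul_add_mul {k m l : Type*} [Fintype k] [Fintype m] [Fintype l]
    [DecidableEq m] [DecidableEq l] {R : Type*} [CommRing R] {U : Matrix k m R} {Q : Matrix k l R}
    {q : Type*} {a : Matrix m q R} {b : Matrix l q R} (hU : Uᵀ * U = 1) (hQ : Qᵀ * Q = 1)
    (hUQb : Uᵀ * (Q * b) = 0) : (U * a + Q * b)ᵀ * (U * a + Q * b) = aᵀ * a + bᵀ * b := by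
  have hQU : (Q * b)ᵀ * U = 0 := by simpa using congrArg Matrix.transpose hUQb
  have hUU : (U * a)ᵀ * (U * a) = aᵀ * a := by
    rw [Matrix.transpose_mul, Matrix.mul_assoc, ← Matrix.mul_assoc Uᵀ, hU, Matrix.one_mul]
  have hQQ : (Q * b)ᵀ * (Q * b) = bᵀ * b := by
    rw [Matrix.transpose_mul, Matrix.mul_assoc, ← Matrix.mul_assoc Qᵀ, hQ, Matrix.one_mul]
  have hUaQb : (U * a)ᵀ * (Q * b) = 0 := by
    rw [Matrix.transpose_mul, Matrix.mul_assoc, hUQb, Matrix.mul_zero]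
  rw [Matrix.transpose_add, Matrix.add_mul, Matrix.mul_add, Matrix.mul_add, hUU, hUaQb, hQQ,
    ← Matrix.mul_assoc, hQU, Matrix.zero_mul, add_zero, zero_add]

namespace IsSolution

variable {N X₀ Y₀ Φ A B : Matrix (Fin p) (Fin p) ℝ}

theorem transpose_eq_neg (h : IsSolution U W Q N X₀ Y₀ Φ A B) :
    (Matrix.fromBlocks A (-Bᵀ) B 0)ᵀ = -Matrix.fromBlocks A (-Bᵀ) B 0 := by
  have hΦ : Matrix.fromBlocks 1 0 0 Φ ∈ Matrix.orthogonalGroup (Fin p ⊕ Fin p) ℝ := by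
    simp [Matrix.mem_orthogonalGroup_iff, Matrix.fromBlocks_transpose, Matrix.fromBlocks_multiply,
      (Matrix.mem_orthogonalGroup_iff (Fin p) ℝ).1 h.Φ_mem]
  refine h.log_eq.transpose_eq_neg ?_
  simpa [Matrix.fromBlocks_multiply] using mul_mem h.completion hΦ

theorem transpose_A (h : IsSolution U W Q N X₀ Y₀ Φ A B) : Aᵀ = -A := by
  have hskew := h.transpose_eq_neg
  rw [Matrix.fromBlocks_transpose, Matrix.fromBlocks_neg, Matrix.fromBlocks_inj] at hskew
  exact hskew.1

theorem mem_tangent (hU : U ∈ St n p) (h : IsSolution U W Q N X₀ Y₀ Φ A B) :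
    U * A + Q * B ∈ tangent U := by
  have hA : Uᵀ * (U * A + Q * B) = A := by
    rw [Matrix.mul_add, ← Matrix.mul_assoc, show Uᵀ * U = 1 from hU, h.orth, Matrix.one_mul,
      add_zero]
  have hAt : (U * A + Q * B)ᵀ * U = Aᵀ := by simpa using congrArg Matrix.transpose hA
  change Uᵀ * (U * A + Q * B) = -((U * A + Q * B)ᵀ * U)
  rw [hA, hAt, h.transpose_A, neg_neg]

theorem mul_add_mul_eq (h : IsSolution U W Q N X₀ Y₀ Φ A B) : U * (Uᵀ * W) + Q * N = W := by
  rw [h.QN_eq, Matrix.sub_mul, Matrix.one_mul, Matrix.mul_assoc, add_sub_cancel]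

theorem Exp_eq (hU : U ∈ St n p) (h : IsSolution U W Q N X₀ Y₀ Φ A B) :
    Exp U (U * A + Q * B) = W := by
  rw [Exp_mul_add_mul hU h.Q_mem h.transpose_A h.orth h.log_eq.1, h.mul_add_mul_eq]

theorem trace_le (hU : U ∈ St n p) (h : IsSolution U W Q N X₀ Y₀ Φ A B) :
    ((U * A + Q * B)ᵀ * (U * A + Q * B)).trace ≤
      Real.pi ^ 2 / 4 * ((W - U)ᵀ * (W - U)).trace := by
  let E₁ : Matrix (Fin p ⊕ Fin p) (Fin p) ℝ := Matrix.fromRows 1 0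
  have hlog : Matrix.fromBlocks A (-Bᵀ) B 0 * E₁ = Matrix.fromRows A B := by
    simp [E₁, Matrix.fromBlocks_mul_fromRows]
  have hexp : (Matrix.fromBlocks (Uᵀ * W) (X₀ * Φ) N (Y₀ * Φ) - 1) * E₁ =
      Matrix.fromRows (Uᵀ * W - 1) N := by
    rw [Matrix.sub_mul, Matrix.fromBlocks_mul_fromRows, Matrix.one_mul]
    ext (i | i) j <;> simp [E₁]
  have hWU : W - U = U * (Uᵀ * W - 1) + Q * N := by
    rw [Matrix.mul_sub, Matrix.mul_one, sub_add_eq_add_sub, h.mul_add_mul_eq]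
  have hUQN : Uᵀ * (Q * N) = 0 := by
    rw [h.QN_eq, ← Matrix.mul_assoc, Matrix.mul_sub, ← Matrix.mul_assoc,
      show Uᵀ * U = 1 from hU, Matrix.mul_one, Matrix.one_mul, sub_self, Matrix.zero_mul]
  have hest := trace_mul_le_trace_exp_sub_one_mul h.transpose_eq_neg
    (fun z hz => (h.log_eq.2 z hz).le) E₁
  rw [h.log_eq.1, hlog, hexp] at hest
  rw [hWU, transpose_mul_self_mul_add_mul hU h.Q_mem h.orth,
    transpose_mul_self_mul_add_mul hU h.Q_mem hUQN]
  simpa only [Matrix.transpose_fromRows, Matrix.fromCols_mul_fromRows] using hest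

end IsSolution

theorem sq_apply_le_trace_transpose_mul_self {m k : Type*} [Fintype m] [Fintype k]
    (X : Matrix m k ℝ) (i : m) (j : k) : X i j ^ 2 ≤ (Xᵀ * X).trace := by
  have hdiag (j : k) : (Xᵀ * X) j j = ∑ i, X i j ^ 2 := by
    simp only [Matrix.mul_apply, Matrix.transpose_apply, sq]
  calc X i j ^ 2 ≤ ∑ i, X i j ^ 2 :=
        Finset.single_le_sum (fun i _ => sq_nonneg (X i j)) (Finset.mem_univ i)
    _ = (Xᵀ * X) j j := (hdiag j).symm
    _ ≤ (Xᵀ * X).trace :=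
        Finset.single_le_sum (f := fun j => (Xᵀ * X) j j)
          (fun j _ => hdiag j ▸ Finset.sum_nonneg fun i _ => sq_nonneg (X i j))
          (Finset.mem_univ j)

theorem norm_lt_of_trace_transpose_mul_self_lt {m k : Type*} [Fintype m] [Fintype k]
    {X : Matrix m k ℝ} {ε : ℝ} (hε : 0 < ε) (hX : (Xᵀ * X).trace < ε ^ 2) : ‖X‖ < ε :=
  (Matrix.norm_lt_iff hε).2 fun i j =>
    abs_lt_of_sq_lt_sq ((sq_apply_le_trace_transpose_mul_self X i j).trans_lt hX) hε.le

theorem eq_Log_of_mem (hinj : Set.InjOn (Exp U) 𝒱) {D : Matrix (Fin n) (Fin p) ℝ} (hD : D ∈ 𝒱)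
    (hW : Exp U D = W) : D = Log U 𝒱 W := by
  rw [← hW]
  exact (hinj.leftInvOn_invFunOn hD).symm

theorem IsOpenNhdIn.inter {S 𝒲 𝒲' : Set (Matrix (Fin n) (Fin p) ℝ)} (h : IsOpenNhdIn S 𝒲 W)
    (h' : IsOpenNhdIn S 𝒲' W) : IsOpenNhdIn S (𝒲 ∩ 𝒲') W := by
  obtain ⟨hW, O, hO, rfl⟩ := h
  obtain ⟨hW', O', hO', rfl⟩ := h'
  exact ⟨⟨hW, hW'⟩, O ∩ O', hO.inter hO', (Set.inter_inter_distrib_left S O O').symm⟩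

theorem exists_isOpenNhdIn_forall_isSolution_mem (hU : U ∈ St n p)
    (h𝒱 : IsOpenNhdIn (tangent U) 𝒱 0) :
    ∃ 𝒟' : Set (Matrix (Fin n) (Fin p) ℝ), IsOpenNhdIn (St n p) 𝒟' U ∧
      ∀ W ∈ 𝒟', ∀ (Q : Matrix (Fin n) (Fin p) ℝ) (N X₀ Y₀ Φ A B : Matrix (Fin p) (Fin p) ℝ),
        IsSolution U W Q N X₀ Y₀ Φ A B → U * A + Q * B ∈ 𝒱 := by
  obtain ⟨h0, O, hO, rfl⟩ := h𝒱
  obtain ⟨ε, hε, hball⟩ := Metric.isOpen_iff.1 hO 0 h0.2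
  have hcont : Continuous fun W : Matrix (Fin n) (Fin p) ℝ =>
      Real.pi ^ 2 / 4 * ((W - U)ᵀ * (W - U)).trace := by
    have hsub : Continuous fun W : Matrix (Fin n) (Fin p) ℝ => W - U :=
      continuous_id.sub continuous_const
    exact continuous_const.mul (hsub.matrix_transpose.matrix_mul hsub).matrix_trace
  refine ⟨St n p ∩ {W | Real.pi ^ 2 / 4 * ((W - U)ᵀ * (W - U)).trace < ε ^ 2},
    ⟨⟨hU, ?_⟩, _, isOpen_lt hcont continuous_const, rfl⟩, ?_⟩
  · simpa using pow_pos hε 2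
  · rintro W ⟨-, hW⟩ Q N X₀ Y₀ Φ A B h
    exact ⟨h.mem_tangent hU, hball (mem_ball_zero_iff.2
      (norm_lt_of_trace_transpose_mul_self_lt hε ((h.trace_le hU).trans_lt hW)))⟩

end Solution

end Stiefel

theorem theorem3p1_general {n p : ℕ} {U : Matrix (Fin n) (Fin p) ℝ} (hU : U ∈ Stiefel.St n p)
    {𝒱 : Set (Matrix (Fin n) (Fin p) ℝ)} (h𝒱 : Stiefel.IsOpenNhdIn (Stiefel.tangent U) 𝒱 0)
    (hinj : Set.InjOn (Stiefel.Exp U) 𝒱) :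
    (∀ (W Q : Matrix (Fin n) (Fin p) ℝ) (N X₀ Y₀ Φ A B : Matrix (Fin p) (Fin p) ℝ),
      Stiefel.IsSolution U W Q N X₀ Y₀ Φ A B →
        U * A + Q * B ∈ Stiefel.tangent U ∧
        Stiefel.Exp U (U * A + Q * B) = W ∧
        (U * A + Q * B ∈ 𝒱 → U * A + Q * B = Stiefel.Log U 𝒱 W)) ∧
    ∃ 𝒟' : Set (Matrix (Fin n) (Fin p) ℝ), Stiefel.IsOpenNhdIn (Stiefel.St n p) 𝒟' U ∧
      ∀ W ∈ 𝒟', ∀ (Q : Matrix (Fin n) (Fin p) ℝ) (N X₀ Y₀ Φ A B : Matrix (Fin p) (Fin p) ℝ),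
        Stiefel.IsSolution U W Q N X₀ Y₀ Φ A B → U * A + Q * B = Stiefel.Log U 𝒱 W := by
  obtain ⟨𝒟', h𝒟', hmem⟩ := Stiefel.exists_isOpenNhdIn_forall_isSolution_mem hU h𝒱
  exact ⟨fun W Q N X₀ Y₀ Φ A B h => ⟨h.mem_tangent hU, h.Exp_eq hU,
      fun hD => Stiefel.eq_Log_of_mem hinj hD (h.Exp_eq hU)⟩,
    𝒟', h𝒟', fun W hW Q N X₀ Y₀ Φ A B h =>
      Stiefel.eq_Log_of_mem hinj (hmem W hW Q N X₀ Y₀ Φ A B h) (h.Exp_eq hU)⟩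

theorem theorem3p1 {n p : ℕ} (U : Matrix (Fin n) (Fin p) ℝ) (hU : U ∈ Stiefel.St n p)
    (𝒱 𝒟 : Set (Matrix (Fin n) (Fin p) ℝ)) (hdiff : Stiefel.IsExpDiffeo U 𝒱 𝒟) :
    (∀ (W : Matrix (Fin n) (Fin p) ℝ), W ∈ 𝒟 →
      ∀ (Q : Matrix (Fin n) (Fin p) ℝ) (N X₀ Y₀ Φ A B : Matrix (Fin p) (Fin p) ℝ),
        Stiefel.IsSolution U W Q N X₀ Y₀ Φ A B →
          U * A + Q * B ∈ Stiefel.tangent U ∧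
          Stiefel.Exp U (U * A + Q * B) = W ∧
          (U * A + Q * B ∈ 𝒱 → U * A + Q * B = Stiefel.Log U 𝒱 W)) ∧
    ∃ 𝒟' : Set (Matrix (Fin n) (Fin p) ℝ), 𝒟' ⊆ 𝒟 ∧
      Stiefel.IsOpenNhdIn (Stiefel.St n p) 𝒟' U ∧
      ∀ (W : Matrix (Fin n) (Fin p) ℝ), W ∈ 𝒟' →
        ∀ (Q : Matrix (Fin n) (Fin p) ℝ) (N X₀ Y₀ Φ A B : Matrix (Fin p) (Fin p) ℝ),
          Stiefel.IsSolution U W Q N X₀ Y₀ Φ A B →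
            U * A + Q * B = Stiefel.Log U 𝒱 W := by
  obtain ⟨hExp, 𝒟', h𝒟', hLog⟩ :=
    theorem3p1_general hU hdiff.nhd_source hdiff.bijOn.injOn
  exact ⟨fun W _ => hExp W, 𝒟 ∩ 𝒟', Set.inter_subset_left, hdiff.nhd_target.inter h𝒟',
    fun W hW => hLog W hW.2⟩
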